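/- **Signed cancellation meadows.** A *meadow* is a commutative ring with unit with a total unary operation $x\mapsto x^{-1}$ such that $(x^{-1})^{-1}=x$ and $x\cdot(x\cdot x^{-1})=x$; write $1_x=x\cdot x^{-1}$ and $0_x=1-1_x$. It is a *cancellation meadow* (zero-totalized field) if $0\neq 1$ and $x\cdot x^{-1}=1$ for all $x\ne 0$. A *signed* meadow has in addition a unary operation $\mathbf s$ with $\mathbf s(1_x)=1_x$, $\mathbf s(0_x)=0_x$, $\mathbf s(-1)=-1$, $\mathbf s(x^{-1})=\mathbf s(x)$, $\mathbf s(x\cdot y)=\mathbf s(x)\cdot\mathbf s(y)$ and $0_{\mathbf s(x)-\mathbf s(y)}\cdot(\mathbf s(x+y)-\mathbf s(x))=0$. **Instruction sequences.** There are input variables $x_0,x_1,\dots$, auxiliary variables $a_0,a_1,\dots$ and an output variable $y$. The basic instructions are the assignments $a_i\Leftarrow x_j$, $a_i\Leftarrow 0$, $a_i\Leftarrow 1$, $a_i\Leftarrow -a_i$, $a_i\Leftarrow a_i^{-1}$, $a_i\Leftarrow a_i+a_j$, $a_i\Leftarrow a_i\cdot a_j$, $a_i\Leftarrow \mathbf s(a_i)$,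 $y\Leftarrow a_j$, which always reply true, and the zero test of $a_i$, which changes nothing and replies true iff the value of $a_i$ is $0$. Instruction sequences are given by $I::=\mathtt a\mid +\mathtt a\mid -\mathtt a\mid \#k\mid\;!\mid I;I\mid I^\omega$, where $\mathtt a$ is a basic instruction and $k\in\mathbb N$. A sequence is executed from its first instruction on: $\mathtt a$ is performed and execution continues with the next instruction; the test instruction $+\mathtt a$ (resp. $-\mathtt a$) does the same but skips the next instruction if the reply is false (resp. true); $\#k$ jumps $k$ instructions ahead; $!$ terminates; and $I^\omega$ is $I$ repeated forever. Execution deadlocks at $\#0$, in an infinite chain of jumps, and when no instruction is left. A *straight-line* instruction sequence is one without repetition, without test instructions $+\mathtt a$, $-\mathtt a$ and without jumps. A sequence *uses $n$ auxiliary variables* if the auxiliary variables occurring in it are precisely $a_0,\dots,a_{n-1}$. For $k\in\mathbb N$ and a signed meadow $\mathcal M$, the partial mapping $[\![I]\!]^k_{\mathcal M}:\mathcal M^{k+1}\rightharpoonup\mathcal M$ sends $(m_0,\dots,m_k)$ to the final value of $y$ when $I$ is executed from the assignment $x_i=m_i$ $(i\le k)$ with all other variables $0$; it is undefined if that execution does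 not terminate by $!$ after finitely many steps. **Theorem.** Let $I$ be an instruction sequence and $k\in\mathbb N$ be such that $[\![I]\!]^k_{\mathcal M}$ is a total mapping on all signed cancellation meadows $\mathcal M$. Then there exists a straight-line instruction sequence $J$ which uses at most $8$ auxiliary variables (that is, uses $n$ auxiliary variables for some $n\le 8$) such that $[\![I]\!]^k_{\mathcal M}=[\![J]\!]^k_{\mathcal M}$ for all signed cancellation meadows $\mathcal M$. -/

import Mathlib

universe u

/-! ## Signed cancellation meadows -/

/-- A meadow: a commutative ring with unit and a total inverse operation satisfying
`(x⁻¹)⁻¹ = x` and the restricted inverse law `x · (x · x⁻¹) = x`. -/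
class Meadow (M : Type*) extends CommRing M, Inv M where
  inv_invol : ∀ x : M, (x⁻¹)⁻¹ = x
  ril : ∀ x : M, x * (x * x⁻¹) = x

/-- The pseudo unit `1_x = x / x`. -/
def Meadow.pseudoUnit {M : Type*} [Meadow M] (x : M) : M := x * x⁻¹

/-- The pseudo zero `0_x = 1 - 1_x`. -/
def Meadow.pseudoZero {M : Type*} [Meadow M] (x : M) : M := 1 - Meadow.pseudoUnit x

/-- A signed meadow: a meadow with a sign operation satisfying the axioms for the sign function. -/
class SignedMeadow (M : Type*) extends Meadow M where
  /-- the sign operation -/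
  sgn : M → M
  sgn_pseudoUnit : ∀ x : M, sgn (Meadow.pseudoUnit x) = Meadow.pseudoUnit x
  sgn_pseudoZero : ∀ x : M, sgn (Meadow.pseudoZero x) = Meadow.pseudoZero x
  sgn_neg_one : sgn (-1) = -1
  sgn_inv : ∀ x : M, sgn x⁻¹ = sgn x
  sgn_mul : ∀ x y : M, sgn (x * y) = sgn x * sgn y
  sgn_add : ∀ x y : M, Meadow.pseudoZero (sgn x - sgn y) * (sgn (x + y) - sgn x) = 0

/-- A cancellation meadow is a zero-totalized field: a nontrivial meadow satisfying the
inverse law. -/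
structure Meadow.IsCancellation (M : Type*) [Meadow M] : Prop where
  zero_ne_one : (0 : M) ≠ 1
  inverse_law : ∀ x : M, x ≠ 0 → x * x⁻¹ = 1

/-! ## Program algebra -/

/-- Primitive instructions over a set `A` of basic instructions: `a`, `+a`, `-a`, `#k`, `!`. -/
inductive Prim (A : Type) where
  | basic (a : A)
  | posTest (a : A)
  | negTest (a : A)
  | jump (k : ℕ)
  | term

/-- Instruction sequences: primitive instructions, concatenation `I;J` and repetition `I^ω`. -/
inductive InsSeq (A : Type) where
  | prim (u : Prim A)
  | seq (I J : InsSeq A)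
  | rep (I : InsSeq A)

namespace InsSeq

variable {A : Type}

/-- The first canonical form `Y;Z^ω` of an instruction sequence, as the pair `(Y, Z)`;
`Z = []` stands for "no repetition", i.e. for the finite sequence `Y`. If `X` already contains
a repetition then `X;X' = X` and `X^ω = X`. -/
def canon : InsSeq A → List (Prim A) × List (Prim A)
  | prim u => ([u], [])
  | seq I J => if I.canon.2 = [] then (I.canon.1 ++ J.canon.1, J.canon.2) else I.canon
  | rep I => if I.canon.2 = [] then ([], I.canon.1) else I.canon

/-- The primitive instruction at position `p` (counted from `0`) of the possibly infinite
sequence `Y;Z;Z;Z;…`; `none` beyond the end of a finite sequence. -/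
def nth (I : InsSeq A) (p : ℕ) : Option (Prim A) :=
  if p < I.canon.1.length then I.canon.1[p]?
  else I.canon.2[(p - I.canon.1.length) % I.canon.2.length]?

/-- There is a jump instruction at position `p`. -/
def IsJumpAt (I : InsSeq A) (p : ℕ) : Prop := ∃ k, I.nth p = some (Prim.jump k)

/-- Follow the jump at position `p`, if there is one. -/
def followJump (I : InsSeq A) (p : ℕ) : ℕ :=
  match I.nth p with
  | some (Prim.jump k) => p + k
  | _ => p

open Classical in
/-- The first position without a jump instruction that is reached from `p` by following jumps;
`none` if there is no such position, because of an instruction `#0` or of an infinite chain of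
jumps. -/
noncomputable def target (I : InsSeq A) (p : ℕ) : Option ℕ :=
  if h : ∃ n, ¬ I.IsJumpAt (I.followJump^[n] p) then some (I.followJump^[Nat.find h] p) else none

/-- Basic instruction `a` occurs in the instruction sequence, plainly or in a test. -/
def Occurs (a : A) : InsSeq A → Prop
  | prim (Prim.basic b) => b = a
  | prim (Prim.posTest b) => b = a
  | prim (Prim.negTest b) => b = a
  | prim (Prim.jump _) => False
  | prim Prim.term => False
  | seq I J => Occurs a I ∨ Occurs a J
  | rep I => Occurs a I

/-- Straight-line instruction sequences: finite (no repetition), without test instructions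
`+a`, `-a` and without jumps. -/
def IsStraightLine : InsSeq A → Prop
  | prim (Prim.basic _) => True
  | prim (Prim.posTest _) => False
  | prim (Prim.negTest _) => False
  | prim (Prim.jump _) => False
  | prim Prim.term => True
  | seq I J => IsStraightLine I ∧ IsStraightLine J
  | rep _ => False

end InsSeq

/-! ## Threads -/

/-- Finite threads; `post T a T'` is the postconditional composition: perform `a`, continue as `T`
upon reply true and as `T'` upon reply false. -/
inductive FinThread (A : Type) where
  | halt
  | dead
  | post (T : FinThread A) (a : A) (T' : FinThread A)

/-- One layer of a thread with continuations in `X`: termination, deadlock, or a postconditional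
composition `T ⊴ a ⊵ T'`. -/
inductive ThreadStep (A X : Type) where
  | halt
  | dead
  | post (T : X) (a : A) (T' : X)

/-- The possible heads of a thread: termination, deadlock, or an action. -/
inductive ThreadHead (A : Type) where
  | halt
  | dead
  | act (a : A)

/-- An action has one continuation for each Boolean reply; termination and deadlock have none. -/
def ThreadHead.Reply {A : Type} : ThreadHead A → Type
  | halt => Empty
  | dead => Empty
  | act _ => Bool

/-- The signature functor of threads. -/
def threadFunctor (A : Type) : PFunctor := ⟨ThreadHead A, ThreadHead.Reply⟩

/-- A layer as an element of the signature functor. -/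
def ThreadStep.toObj {A X : Type} : ThreadStep A X → (threadFunctor A).Obj X
  | halt => ⟨ThreadHead.halt, Empty.elim⟩
  | dead => ⟨ThreadHead.dead, Empty.elim⟩
  | post T a T' => ⟨ThreadHead.act a, fun b : Bool => if b then T else T'⟩

/-- Finite and infinite threads (equivalently, projective sequences of finite threads): the final
coalgebra of the signature functor. -/
def Thread (A : Type) : Type := (threadFunctor A).M

/-- The outermost layer of a thread. -/
def Thread.unfold {A : Type} (T : Thread A) : ThreadStep A (Thread A) :=
  match PFunctor.M.dest (F := threadFunctor A) T with
  | ⟨ThreadHead.halt, _⟩ => ThreadStep.halt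
  | ⟨ThreadHead.dead, _⟩ => ThreadStep.dead
  | ⟨ThreadHead.act a, f⟩ => ThreadStep.post (f true) a (f false)

/-- The thread generated from a state by a system of equations `x = step x`. -/
def Thread.generate {A X : Type} (step : X → ThreadStep A X) (x : X) : Thread A :=
  PFunctor.M.corec (F := threadFunctor A) (fun z => (step z).toObj) x

/-- The generated threads satisfy the equations of the system. -/
theorem Thread.unfold_generate {A X : Type} (step : X → ThreadStep A X) (x : X) :
    (Thread.generate step x).unfold =
      match step x with
      | ThreadStep.halt => ThreadStep.halt
      | ThreadStep.dead => ThreadStep.dead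
      | ThreadStep.post y a z =>
        ThreadStep.post (Thread.generate step y) a (Thread.generate step z) := by
  rw [Thread.unfold, Thread.generate, PFunctor.M.dest_corec]
  cases step x <;> rfl

/-- The approximation operator `π_n`: behaviour up to depth `n`. -/
def Thread.proj {A : Type} : ℕ → Thread A → FinThread A
  | 0, _ => FinThread.dead
  | n + 1, T =>
    match T.unfold with
    | ThreadStep.halt => FinThread.halt
    | ThreadStep.dead => FinThread.dead
    | ThreadStep.post T₁ a T₂ => FinThread.post (Thread.proj n T₁) a (Thread.proj n T₂)

/-- One step of thread extraction from position `p`: the outermost layer of the thread, with the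
positions where execution continues for the two replies. A plain or test instruction is performed
as an action; a positive (negative) test skips one instruction upon reply false (true). -/
noncomputable def InsSeq.extractStep {A : Type} (I : InsSeq A) (p : ℕ) : ThreadStep A ℕ :=
  match I.target p with
  | none => ThreadStep.dead
  | some q =>
    match I.nth q with
    | some (Prim.basic a) => ThreadStep.post (q + 1) a (q + 1)
    | some (Prim.posTest a) => ThreadStep.post (q + 1) a (q + 2)
    | some (Prim.negTest a) => ThreadStep.post (q + 2) a (q + 1)
    | some (Prim.jump _) => ThreadStep.dead
    | some Prim.term => ThreadStep.halt
    | none => ThreadStep.dead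

/-- Thread extraction `|I|`. -/
noncomputable def InsSeq.thread {A : Type} (I : InsSeq A) : Thread A :=
  Thread.generate I.extractStep 0

/-! ## Calculation on signed meadows -/

/-- Input variables `x_i`, auxiliary variables `a_i`, and the output variable `y`. -/
inductive Var where
  | x (i : ℕ)
  | a (i : ℕ)
  | y
  deriving DecidableEq

/-- The basic instructions. -/
inductive Ins where
  /-- `a_i.cp(x_j)` -/
  | cpIn (i j : ℕ)
  /-- `a_i.set:0` -/
  | setZero (i : ℕ)
  /-- `a_i.set:1` -/
  | setOne (i : ℕ)
  /-- `a_i.set:ai` -/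
  | setNeg (i : ℕ)
  /-- `a_i.set:mi` -/
  | setInv (i : ℕ)
  /-- `a_i.set:a(a_j)` -/
  | setAdd (i j : ℕ)
  /-- `a_i.set:m(a_j)` -/
  | setMul (i j : ℕ)
  /-- `a_i.set:s` -/
  | setSign (i : ℕ)
  /-- `a_i.test:0` -/
  | testZero (i : ℕ)
  /-- `y.cp(a_j)` -/
  | cpOut (j : ℕ)

namespace Ins

/-- The set of indices of the auxiliary variables occurring in a basic instruction. -/
def auxVars : Ins → Set ℕ
  | cpIn i _ => {i}
  | setZero i => {i}
  | setOne i => {i}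
  | setNeg i => {i}
  | setInv i => {i}
  | setAdd i j => {i, j}
  | setMul i j => {i, j}
  | setSign i => {i}
  | testZero i => {i}
  | cpOut j => {j}

variable {M : Type*} [SignedMeadow M]

/-- The effect of a basic instruction on an assignment. -/
def effect : Ins → (Var → M) → (Var → M)
  | cpIn i j, α => Function.update α (Var.a i) (α (Var.x j))
  | setZero i, α => Function.update α (Var.a i) 0
  | setOne i, α => Function.update α (Var.a i) 1
  | setNeg i, α => Function.update α (Var.a i) (-α (Var.a i))
  | setInv i, α => Function.update α (Var.a i) (α (Var.a i))⁻¹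
  | setAdd i j, α => Function.update α (Var.a i) (α (Var.a i) + α (Var.a j))
  | setMul i j, α => Function.update α (Var.a i) (α (Var.a i) * α (Var.a j))
  | setSign i, α => Function.update α (Var.a i) (SignedMeadow.sgn (α (Var.a i)))
  | testZero _, α => α
  | cpOut j, α => Function.update α Var.y (α (Var.a j))

/-- The reply of a basic instruction is true: always for assignment instructions, and for a zero
test if the tested value is `0`. -/
def ReplyTrue : Ins → (Var → M) → Prop
  | testZero i, α => α (Var.a i) = 0
  | _, _ => True

end Ins

/-- The set `R_{T,n}` of all assignments on which `T` terminates after at most `n` steps. -/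
def Thread.termSet {M : Type*} [SignedMeadow M] : ℕ → Thread Ins → Set (Var → M)
  | 0, T =>
    match T.unfold with
    | ThreadStep.halt => Set.univ
    | ThreadStep.dead => ∅
    | ThreadStep.post _ _ _ => ∅
  | n + 1, T =>
    match T.unfold with
    | ThreadStep.halt => Set.univ
    | ThreadStep.dead => ∅
    | ThreadStep.post T₁ a T₂ =>
      {α | a.ReplyTrue α ∧ a.effect α ∈ Thread.termSet n T₁} ∪
        {α | ¬ a.ReplyTrue α ∧ a.effect α ∈ Thread.termSet n T₂}

open Classical in
/-- The apply operator `T • α` for finite threads; `none` is deadlock. -/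
noncomputable def FinThread.apply {M : Type*} [SignedMeadow M] :
    FinThread Ins → (Var → M) → Option (Var → M)
  | halt, α => some α
  | dead, _ => none
  | post T a T', α => if a.ReplyTrue α then T.apply (a.effect α) else T'.apply (a.effect α)

/-- If `T` terminates on `α` after at most `n` steps, then `π_{n+1}(T) • α` is not deadlock. -/
theorem Thread.isSome_apply_proj {M : Type*} [SignedMeadow M] (n : ℕ) (T : Thread Ins)
    (α : Var → M) (h : α ∈ Thread.termSet n T) :
    (((Thread.proj (n + 1) T).apply α).isSome : Prop) := by
  induction n generalizing T α with
  | zero =>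
    rw [Thread.termSet] at h
    rw [Thread.proj]
    cases hT : T.unfold <;> simp_all [FinThread.apply]
  | succ n ih =>
    rw [Thread.termSet] at h
    rw [Thread.proj]
    cases hT : T.unfold with
    | halt => simp [FinThread.apply]
    | dead => simp [hT] at h
    | post T₁ a T₂ =>
      simp only [hT] at h
      rcases h with ⟨h1, h2⟩ | ⟨h1, h2⟩
      · simpa [FinThread.apply, h1] using ih _ _ h2
      · simpa [FinThread.apply, h1] using ih _ _ h2

/-- The initial assignment with `x_i = m_i` for `i ≤ k` and value `0` on all other variables. -/
def initAssignment {M : Type*} [SignedMeadow M] {k : ℕ} (m : Fin (k + 1) → M) : Var → M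
  | Var.x i => if h : i < k + 1 then m ⟨i, h⟩ else 0
  | Var.a _ => 0
  | Var.y => 0

open Classical in
/-- The partial mapping `M^{k+1} ⇀ M` computed by a thread `T`: its value is
`(π_{n+1}(T) • α)(y)` if the initial assignment `α` is in `R_{T,n}` (here with the least such `n`;
larger `n` give the same value), and it is undefined if there is no such `n`. -/
noncomputable def Thread.sem (M : Type*) [SignedMeadow M] (k : ℕ) (T : Thread Ins) :
    (Fin (k + 1) → M) →. M :=
  fun m =>
    { Dom := ∃ n, initAssignment m ∈ Thread.termSet n T
      get := fun h =>
        ((Thread.proj (Nat.find h + 1) T).apply (initAssignment m)).get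
          (Thread.isSome_apply_proj _ _ _ (Nat.find_spec h)) Var.y }

/-- The partial mapping `M^{k+1} ⇀ M` computed by an instruction sequence. -/
noncomputable def InsSeq.sem (M : Type*) [SignedMeadow M] (k : ℕ) (I : InsSeq Ins) :
    (Fin (k + 1) → M) →. M :=
  Thread.sem M k I.thread

/-- The instruction sequence uses the auxiliary variable `a_i`. -/
def InsSeq.UsesAuxVar (I : InsSeq Ins) (i : ℕ) : Prop :=
  ∃ a : Ins, I.Occurs a ∧ i ∈ a.auxVars

/-- The instruction sequence uses `n` auxiliary variables: it uses precisely
`a_0, …, a_{n-1}`. -/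
def InsSeq.UsesAuxVars (I : InsSeq Ins) (n : ℕ) : Prop :=
  ∀ i : ℕ, I.UsesAuxVar i ↔ i < n

/-! Compactness bounds the running time. If for every `n` some input from a signed cancellation
meadow needed more than `n` steps, the class of these inputs in an ultraproduct over a nonprincipal
ultrafilter would be an input on which the thread never terminates, although the ultraproduct is
again a signed cancellation meadow (`Thread.exists_uniform_bound`). So the thread may be replaced by
one finite approximation, the same for all meadows.

A finite thread is executed symbolically, each variable holding a fraction of integer polynomials in
the inputs. Zero tests, applications of `s` and vanishing denominators in additions force case
distinctions on the sign of a polynomial `r`. On nonzero elements `s` is `±1` and `2` is invertible,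
so the indicators of the three cases are `1 - s(r²)`, `(s(r²) + s(r))/2` and `(s(r²) - s(r))/2`.
Hence all branches merge into a single sum of terms `p · q⁻¹ · s(r)`
(`SignedFrac.exists_sumEval_cases`, `FinThread.exists_expresses`).

Such a sum needs five registers, one per nesting level: sum, product, polynomial, monomial, input
(`RegisterCode.exists_computes_add_sumEval`). Thus five auxiliary variables suffice, within the
required eight. -/

open MvPolynomial

/-! ## Signed cancellation meadows as ordered fields -/

namespace Meadow

variable {M : Type*}

theorem inv_zero_eq [Meadow M] : (0 : M)⁻¹ = 0 := by
  have h := Meadow.ril ((0 : M)⁻¹)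
  rw [Meadow.inv_invol, mul_zero, mul_zero] at h
  exact h.symm

theorem IsCancellation.inv_one [Meadow M] (h : IsCancellation M) : (1 : M)⁻¹ = 1 := by
  have := h.inverse_law 1 h.zero_ne_one.symm
  rwa [one_mul] at this

/-- A cancellation meadow as a field. -/
abbrev IsCancellation.field [Meadow M] (h : IsCancellation M) : Field M where
  __ := (inferInstance : CommRing M)
  inv := Inv.inv
  exists_pair_ne := ⟨0, 1, h.zero_ne_one⟩
  mul_inv_cancel := h.inverse_law
  inv_zero := inv_zero_eq
  nnqsmul := _
  nnqsmul_def := fun _ _ => rfl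
  qsmul := _
  qsmul_def := fun _ _ => rfl

end Meadow

namespace SignedMeadow

open Meadow

variable {M : Type*} [SignedMeadow M]

theorem sgn_zero : sgn (0 : M) = 0 := by
  have h := sgn_pseudoUnit (0 : M)
  simpa [pseudoUnit] using h

theorem sgn_one : sgn (1 : M) = 1 := by
  have h := sgn_pseudoZero (0 : M)
  simpa [pseudoZero, pseudoUnit] using h

/-- Since `s(x⁻¹) = s(x)`, the square of `s(x)` is `s(x · x⁻¹) = s(1) = 1`. -/
theorem sgn_eq_one_or (h : IsCancellation M) {x : M} (hx : x ≠ 0) :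
    sgn x = 1 ∨ sgn x = -1 := by
  let _ := h.field
  have h1 : sgn x * sgn x = 1 := by
    nth_rewrite 2 [← sgn_inv x]
    rw [← sgn_mul, h.inverse_law x hx, sgn_one]
  exact mul_self_eq_one_iff.mp h1

/-- The addition axiom at `1, 1` has pseudo zero `0_0 = 1` and gives `s(2) = s(1) = 1`, whereas
`s(0) = 0`. -/
theorem two_ne_zero (h : IsCancellation M) : (2 : M) ≠ 0 := by
  intro h2
  have h1 := sgn_add (1 : M) 1
  rw [one_add_one_eq_two, h2, sgn_zero, sgn_one] at h1
  simp only [pseudoZero, pseudoUnit, sub_self, zero_mul, sub_zero, one_mul, zero_sub,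
    neg_eq_zero] at h1
  exact h.zero_ne_one h1.symm

end SignedMeadow

/-! ## Operational semantics -/

namespace Thread

variable {M : Type*} [SignedMeadow M]

theorem mem_termSet_iff (n : ℕ) (T : Thread Ins) (α : Var → M) :
    α ∈ termSet n T ↔ (((proj (n + 1) T).apply α).isSome : Prop) := by
  refine ⟨isSome_apply_proj n T α, ?_⟩
  induction n generalizing T α with
  | zero =>
    rw [termSet, proj]
    cases hT : T.unfold with
    | halt => simp
    | dead => simp [FinThread.apply]
    | post T₁ a T₂ => simp [FinThread.apply, proj]
  | succ n ih =>
    rw [termSet, proj]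
    cases hT : T.unfold with
    | halt => simp
    | dead => simp [FinThread.apply]
    | post T₁ a T₂ =>
      intro h
      by_cases hr : a.ReplyTrue α
      · exact Or.inl ⟨hr, ih _ _ (by simpa [FinThread.apply, hr] using h)⟩
      · exact Or.inr ⟨hr, ih _ _ (by simpa [FinThread.apply, hr] using h)⟩

theorem apply_proj_succ (n : ℕ) (T : Thread Ins) (α β : Var → M)
    (h : (proj n T).apply α = some β) : (proj (n + 1) T).apply α = some β := by
  induction n generalizing T α with
  | zero => simp [proj, FinThread.apply] at h
  | succ n ih =>
    rw [proj] at h ⊢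
    cases hT : T.unfold with
    | halt => simpa [hT] using h
    | dead => simp [hT, FinThread.apply] at h
    | post T₁ a T₂ =>
      simp only [hT, FinThread.apply] at h ⊢
      split_ifs at h ⊢
      · exact ih _ _ h
      · exact ih _ _ h

theorem apply_proj_mono {n n' : ℕ} (hn : n ≤ n') (T : Thread Ins) (α β : Var → M)
    (h : (proj n T).apply α = some β) : (proj n' T).apply α = some β := by
  induction hn with
  | refl => exact h
  | step _ ih => exact apply_proj_succ _ _ _ _ ih

theorem termSet_mono {n n' : ℕ} (hn : n ≤ n') (T : Thread Ins) (α : Var → M)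
    (h : α ∈ termSet n T) : α ∈ termSet n' T := by
  rw [mem_termSet_iff, Option.isSome_iff_exists] at h ⊢
  obtain ⟨β, hβ⟩ := h
  exact ⟨β, apply_proj_mono (by omega) _ _ _ hβ⟩

/-- Results persist when the depth grows, so any sufficient depth may stand in for the least one
used by `sem`. -/
theorem sem_eq_some {k n : ℕ} {T : Thread Ins} {m : Fin (k + 1) → M} {β : Var → M}
    (h : (proj n T).apply (initAssignment m) = some β) :
    T.sem M k m = Part.some (β Var.y) := by
  classical
  have hd : ∃ n, initAssignment m ∈ termSet n T :=
    ⟨n, by rw [mem_termSet_iff, apply_proj_succ _ _ _ _ h]; rfl⟩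
  refine Part.eq_some_iff.mpr ⟨hd, ?_⟩
  simp only [sem]
  have hs := isSome_apply_proj _ _ _ (Nat.find_spec hd)
  obtain ⟨γ, hγ⟩ := Option.isSome_iff_exists.mp hs
  have h1 := apply_proj_mono (le_max_left n (Nat.find hd + 1)) _ _ _ h
  have h2 := apply_proj_mono (le_max_right n (Nat.find hd + 1)) _ _ _ hγ
  have h3 : γ = β := Option.some.inj (h2.symm.trans h1)
  subst h3
  exact congrFun (Option.get_of_eq_some _ hγ) Var.y

end Thread

/-! ## Straight-line code -/

/-- The effect of performing a list of basic instructions. -/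
def runCode {M : Type*} [SignedMeadow M] : List Ins → (Var → M) → (Var → M)
  | [], α => α
  | a :: c, α => runCode c (a.effect α)

theorem runCode_append {M : Type*} [SignedMeadow M] (c d : List Ins) (α : Var → M) :
    runCode (c ++ d) α = runCode d (runCode c α) := by
  induction c generalizing α with
  | nil => rfl
  | cons a c ih => exact ih _

/-- The instruction sequence performing a list of basic instructions and then terminating. -/
def InsSeq.ofCode {A : Type} : List A → InsSeq A
  | [] => prim Prim.term
  | a :: c => seq (prim (Prim.basic a)) (ofCode c)

namespace InsSeq

variable {A : Type}

theorem isStraightLine_ofCode (c : List A) : (ofCode c).IsStraightLine := by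
  induction c with
  | nil => trivial
  | cons a c ih => exact ⟨trivial, ih⟩

theorem occurs_ofCode (a : A) (c : List A) : (ofCode c).Occurs a ↔ a ∈ c := by
  induction c with
  | nil => simp [ofCode, Occurs]
  | cons b c ih => simp [ofCode, Occurs, ih, eq_comm]

theorem canon_ofCode (c : List A) :
    (ofCode c).canon = (c.map Prim.basic ++ [Prim.term], []) := by
  induction c with
  | nil => rfl
  | cons b c ih => simp [ofCode, canon, ih]

theorem nth_ofCode (c : List A) (p : ℕ) :
    (ofCode c).nth p = (c.map Prim.basic ++ [Prim.term])[p]? := by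
  simp only [nth, canon_ofCode]
  split_ifs with h
  · rfl
  · rw [List.getElem?_eq_none (not_lt.mp h)]; simp

theorem target_eq_some (I : InsSeq A) (p : ℕ) (h : ¬ I.IsJumpAt p) : I.target p = some p := by
  classical
  have hex : ∃ n, ¬ I.IsJumpAt (I.followJump^[n] p) := ⟨0, h⟩
  have h0 : Nat.find hex = 0 := (Nat.find_eq_zero hex).mpr h
  rw [target, dif_pos hex]
  congr 1
  convert rfl
  simp [h0]

theorem extractStep_ofCode (c d : List A) :
    (ofCode (c ++ d)).extractStep c.length = match d with
      | [] => ThreadStep.halt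
      | a :: _ => ThreadStep.post (c.length + 1) a (c.length + 1) := by
  have hn : (ofCode (c ++ d)).nth c.length = (d.map Prim.basic ++ [Prim.term])[0]? := by
    rw [nth_ofCode, List.map_append, List.append_assoc, List.getElem?_append_right (by simp)]
    simp
  have ht : (ofCode (c ++ d)).target c.length = some c.length := by
    apply target_eq_some
    rintro ⟨k, hk⟩
    rw [hn] at hk
    cases d <;> simp at hk
  simp only [extractStep, ht, hn]
  cases d <;> simp

/-- The split `c ++ d` separates the code already performed from the code to come; the induction
moves one instruction from `d` to `c`. The extra unit of depth is for the final termination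
instruction. -/
theorem apply_proj_ofCode {M : Type*} [SignedMeadow M] (c d : List Ins) (α : Var → M) :
    (Thread.proj (d.length + 1) (Thread.generate (ofCode (c ++ d)).extractStep c.length)).apply α
      = some (runCode d α) := by
  induction d generalizing c α with
  | nil =>
    rw [Thread.proj, Thread.unfold_generate, extractStep_ofCode]
    rfl
  | cons a d ih =>
    have h := ih (c ++ [a]) (a.effect α)
    rw [List.append_assoc, List.length_append] at h
    rw [Thread.proj, Thread.unfold_generate, extractStep_ofCode]
    simp only [FinThread.apply, ite_self]
    exact h

theorem sem_ofCode {M : Type*} [SignedMeadow M] {k : ℕ} (c : List Ins) (m : Fin (k + 1) → M) :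
    (ofCode c).sem M k m = Part.some (runCode c (initAssignment m) Var.y) :=
  Thread.sem_eq_some (apply_proj_ofCode [] c _)

end InsSeq

/-! ## Ultraproducts of signed meadows -/

namespace Ultraproduct

open Filter Meadow SignedMeadow

variable (M : ℕ → Type u) [∀ n, SignedMeadow (M n)] (F : Ultrafilter ℕ)

/-- The ideal of sequences that vanish almost everywhere. -/
def nullIdeal : Ideal (∀ n, M n) where
  carrier := {f | ∀ᶠ n in F, f n = 0}
  add_mem' := by
    intro f g hf hg
    filter_upwards [hf, hg] with n h1 h2
    simp [h1, h2]
  zero_mem' := by simp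
  smul_mem' := by
    intro c f hf
    filter_upwards [hf] with n h1
    simp [h1]

/-- The ultraproduct of a sequence of signed meadows. -/
abbrev Carrier : Type u := (∀ n, M n) ⧸ nullIdeal M F

variable {M}

/-- The class of a sequence. -/
def mk (f : ∀ n, M n) : Carrier M F := Ideal.Quotient.mk _ f

variable {F}

theorem mk_eq {f g : ∀ n, M n} : mk F f = mk F g ↔ ∀ᶠ n in F, f n = g n := by
  rw [mk, mk, Ideal.Quotient.eq]
  change (∀ᶠ n in F, (f - g) n = 0) ↔ _
  simp [sub_eq_zero]

theorem mk_surjective (x : Carrier M F) : ∃ f, mk F f = x := Ideal.Quotient.mk_surjective x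

variable (M F)

/-- The operation on the ultraproduct induced by unary operations on the components. -/
def map (u : ∀ n, M n → M n) : Carrier M F → Carrier M F :=
  Quotient.lift (fun f => mk F (fun n => u n (f n))) (by
    intro f g h
    have h' : mk F f = mk F g := Quotient.sound h
    rw [mk_eq] at h' ⊢
    filter_upwards [h'] with n hn
    rw [hn])

variable {M}

theorem mk_zero : mk F (fun n => (0 : M n)) = 0 := rfl
theorem mk_one : mk F (fun n => (1 : M n)) = 1 := rfl
theorem mk_mul (f g : ∀ n, M n) : mk F (fun n => f n * g n) = mk F f * mk F g := rfl

instance : Meadow (Carrier M F) where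
  inv := map M F (fun _ x => x⁻¹)
  inv_invol := by
    intro x
    obtain ⟨f, rfl⟩ := mk_surjective x
    exact congrArg (mk F) (funext fun n => inv_invol (f n))
  ril := by
    intro x
    obtain ⟨f, rfl⟩ := mk_surjective x
    exact congrArg (mk F) (funext fun n => ril (f n))

theorem mk_inv (f : ∀ n, M n) : mk F (fun n => (f n)⁻¹) = (mk F f)⁻¹ := rfl

instance : SignedMeadow (Carrier M F) where
  sgn := map M F (fun _ x => sgn x)
  sgn_pseudoUnit := by
    intro x
    obtain ⟨f, rfl⟩ := mk_surjective x
    exact congrArg (mk F) (funext fun n => sgn_pseudoUnit (f n))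
  sgn_pseudoZero := by
    intro x
    obtain ⟨f, rfl⟩ := mk_surjective x
    exact congrArg (mk F) (funext fun n => sgn_pseudoZero (f n))
  sgn_neg_one := congrArg (mk F) (funext fun n => sgn_neg_one (M := M n))
  sgn_inv := by
    intro x
    obtain ⟨f, rfl⟩ := mk_surjective x
    exact congrArg (mk F) (funext fun n => sgn_inv (f n))
  sgn_mul := by
    intro x y
    obtain ⟨f, rfl⟩ := mk_surjective x
    obtain ⟨g, rfl⟩ := mk_surjective y
    exact congrArg (mk F) (funext fun n => sgn_mul (f n) (g n))
  sgn_add := by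
    intro x y
    obtain ⟨f, rfl⟩ := mk_surjective x
    obtain ⟨g, rfl⟩ := mk_surjective y
    exact congrArg (mk F) (funext fun n => sgn_add (f n) (g n))

/-- The inverse law is conditional, so it does not pass to arbitrary reduced products. Over an
ultrafilter a nonzero class is nonzero almost everywhere, and the law applies there. -/
theorem isCancellation (h : ∀ n, IsCancellation (M n)) : IsCancellation (Carrier M F) where
  zero_ne_one := by
    rw [← mk_zero, ← mk_one, Ne, mk_eq]
    simp [(h _).zero_ne_one, F.neBot.ne]
  inverse_law := by
    intro x hx
    obtain ⟨f, rfl⟩ := mk_surjective x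
    rw [← mk_zero, Ne, mk_eq, ← Ultrafilter.eventually_not] at hx
    rw [← mk_inv, ← mk_mul, ← mk_one, mk_eq]
    filter_upwards [hx] with n hn
    exact (h n).inverse_law _ hn

/-- The assignment in the ultraproduct given by a sequence of assignments. -/
def mkAssignment (α : ∀ n, Var → M n) : Var → Carrier M F := fun v => mk F (fun n => α n v)

variable {F}

theorem mkAssignment_update (α : ∀ n, Var → M n) (v : Var) (f : ∀ n, M n) :
    mkAssignment (M := M) F (fun n => Function.update (α n) v (f n)) =
      Function.update (mkAssignment (M := M) F α) v (mk F f) := by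
  funext w
  by_cases h : w = v
  · subst h
    simp [mkAssignment]
  · simp [mkAssignment, h]

theorem effect_mkAssignment (a : Ins) (α : ∀ n, Var → M n) :
    a.effect (mkAssignment (M := M) F α) = mkAssignment (M := M) F (fun n => a.effect (α n)) := by
  cases a <;> first | rfl | exact (mkAssignment_update _ _ _).symm

theorem replyTrue_mkAssignment (a : Ins) (α : ∀ n, Var → M n) :
    a.ReplyTrue (mkAssignment (M := M) F α) ↔ ∀ᶠ n in F, a.ReplyTrue (α n) := by
  cases a with
  | testZero i => exact mk_eq (f := fun n => α n (Var.a i)) (g := fun n => 0)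
  | _ => simp [Ins.ReplyTrue]

theorem initAssignment_mk {k : ℕ} (m : ∀ n, Fin (k + 1) → M n) :
    initAssignment (fun i => mk F (fun n => m n i)) =
      mkAssignment (M := M) F (fun n => initAssignment (m n)) := by
  funext v
  cases v with
  | x i =>
    by_cases h : i < k + 1
    · simp [initAssignment, mkAssignment, h]
    · simp [initAssignment, mkAssignment, h, mk_zero]
  | _ => rfl

/-- An instance of Łoś's theorem: termination within a fixed number of steps is a finite Boolean
condition on zero tests. The ultrafilter property is needed for false replies. -/
theorem eventually_mem_termSet (N : ℕ) (T : Thread Ins) (α : ∀ n, Var → M n)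
    (h : mkAssignment (M := M) F α ∈ Thread.termSet N T) : ∀ᶠ n in F, α n ∈ Thread.termSet N T := by
  induction N generalizing T α with
  | zero =>
    rw [Thread.termSet] at h
    simp only [Thread.termSet]
    cases hT : T.unfold <;> simp_all
  | succ N ih =>
    rw [Thread.termSet] at h
    simp only [Thread.termSet]
    cases hT : T.unfold with
    | halt => simp
    | dead => simp [hT] at h
    | post T₁ a T₂ =>
      simp only [hT] at h
      rcases h with ⟨h1, h2⟩ | ⟨h1, h2⟩
      · rw [replyTrue_mkAssignment] at h1
        rw [effect_mkAssignment] at h2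
        filter_upwards [h1, ih _ (fun n => a.effect (α n)) h2] with n h3 h4 using Or.inl ⟨h3, h4⟩
      · rw [replyTrue_mkAssignment, ← Ultrafilter.eventually_not] at h1
        rw [effect_mkAssignment] at h2
        filter_upwards [h1, ih _ (fun n => a.effect (α n)) h2] with n h3 h4 using Or.inr ⟨h3, h4⟩

end Ultraproduct

/-- A thread that terminates on all inputs from all signed cancellation meadows does so within a
uniformly bounded number of steps. -/
theorem Thread.exists_uniform_bound (T : Thread Ins) (k : ℕ)
    (hT : ∀ (M : Type u) [SignedMeadow M], Meadow.IsCancellation M →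
      ∀ m : Fin (k + 1) → M, (T.sem M k m).Dom) :
    ∃ N, ∀ (M : Type u) [SignedMeadow M], Meadow.IsCancellation M →
      ∀ m : Fin (k + 1) → M, initAssignment m ∈ termSet N T := by
  -- For each `n`, pick a meadow `M n` and an input `m n` on which `T` does not terminate within `n`
  -- steps.
  by_contra! hc
  choose M inst hM m hm using hc
  let F : Ultrafilter ℕ := Filter.hyperfilter ℕ
  -- The index set is `ℕ`, so the ultraproduct stays in universe `u` and totality applies to it.
  obtain ⟨N, hN⟩ := hT (Ultraproduct.Carrier M F) (Ultraproduct.isCancellation F hM)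
    (fun i => Ultraproduct.mk F (fun n => m n i))
  rw [Ultraproduct.initAssignment_mk] at hN
  have h1 := Ultraproduct.eventually_mem_termSet N T _ hN
  have h2 : ∀ᶠ n in F, N ≤ n :=
    Filter.Eventually.filter_mono Nat.hyperfilter_le_atTop (Filter.eventually_ge_atTop N)
  obtain ⟨n, h3, h4⟩ := (h1.and h2).exists
  exact hm n (termSet_mono h4 _ _ h3)

/-! ## Signed fractions -/

/-- A formal product `p · q⁻¹ · s(r)` of integer polynomials in the input variables. -/
structure SignedFrac where
  /-- the numerator -/
  num : MvPolynomial ℕ ℤ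
  /-- the denominator -/
  den : MvPolynomial ℕ ℤ
  /-- the argument of the sign -/
  arg : MvPolynomial ℕ ℤ

namespace SignedFrac

open SignedMeadow

variable {M : Type*} [SignedMeadow M]

/-- The value of a signed fraction. -/
noncomputable def eval (ξ : ℕ → M) (t : SignedFrac) : M :=
  aeval ξ t.num * (aeval ξ t.den)⁻¹ * sgn (aeval ξ t.arg)

/-- The value of a formal sum of signed fractions. -/
noncomputable def sumEval (ξ : ℕ → M) (L : List SignedFrac) : M := (L.map (eval ξ)).sum

/-- Multiplication of a signed fraction by `p · q⁻¹ · s(r)`. -/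
noncomputable def scale (p q r : MvPolynomial ℕ ℤ) (t : SignedFrac) : SignedFrac :=
  ⟨p * t.num, q * t.den, r * t.arg⟩

theorem sumEval_append (ξ : ℕ → M) (L L' : List SignedFrac) :
    sumEval ξ (L ++ L') = sumEval ξ L + sumEval ξ L' := by simp [sumEval]

theorem sumEval_scale (h : Meadow.IsCancellation M) (ξ : ℕ → M) (p q r : MvPolynomial ℕ ℤ)
    (L : List SignedFrac) :
    sumEval ξ (L.map (scale p q r)) =
      aeval ξ p * (aeval ξ q)⁻¹ * sgn (aeval ξ r) * sumEval ξ L := by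
  let _ := h.field
  have hi : ∀ x y : M, (x * y)⁻¹ = x⁻¹ * y⁻¹ := fun x y => mul_inv x y
  induction L with
  | nil => simp [sumEval]
  | cons t L ih =>
    simp only [sumEval, List.map_cons, List.sum_cons] at ih ⊢
    rw [ih]
    simp only [eval, scale, map_mul, hi, sgn_mul]
    ring

/-- Sums of signed fractions are closed under case distinction on the sign of a polynomial. -/
theorem exists_sumEval_cases (r : MvPolynomial ℕ ℤ) (L₀ L₁ L₂ : List SignedFrac) :
    ∃ L : List SignedFrac, ∀ (M : Type u) [SignedMeadow M], Meadow.IsCancellation M →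
      ∀ ξ : ℕ → M, (aeval ξ r = 0 → sumEval ξ L = sumEval ξ L₀) ∧
        (sgn (aeval ξ r) = 1 → sumEval ξ L = sumEval ξ L₁) ∧
        (sgn (aeval ξ r) = -1 → sumEval ξ L = sumEval ξ L₂) := by
  -- The weights are `1 - s(r²)` on `L₀`, `(s(r) + s(r²))/2` on `L₁` and `(-s(r) + s(r²))/2` on
  -- `L₂`.
  refine ⟨L₀ ++ L₀.map (scale (-1) 1 (r * r)) ++ L₁.map (scale 1 2 r) ++
    L₁.map (scale 1 2 (r * r)) ++ L₂.map (scale (-1) 2 r) ++ L₂.map (scale 1 2 (r * r)), ?_⟩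
  intro M _ h ξ
  have h2 : (2 : M) * (2 : M)⁻¹ = 1 := h.inverse_law _ (two_ne_zero h)
  simp only [sumEval_append, sumEval_scale h, map_mul, map_neg, map_one, map_ofNat, sgn_mul, h.inv_one]
  refine ⟨fun hr => ?_, fun hr => ?_, fun hr => ?_⟩
  · rw [hr, sgn_zero]; ring
  · rw [hr]; linear_combination (sumEval ξ L₁) * h2
  · rw [hr]; linear_combination (sumEval ξ L₂) * h2

end SignedFrac

/-! ## Symbolic execution -/

namespace FinThread

open SignedMeadow SignedFrac

/-- The assignment denoted by a symbolic assignment of fractions to variables. -/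
noncomputable def symEval {M : Type*} [SignedMeadow M] (ξ : ℕ → M)
    (S : Var → MvPolynomial ℕ ℤ × MvPolynomial ℕ ℤ) : Var → M :=
  fun v => aeval ξ (S v).1 * (aeval ξ (S v).2)⁻¹

theorem symEval_update {M : Type*} [SignedMeadow M] (ξ : ℕ → M)
    (S : Var → MvPolynomial ℕ ℤ × MvPolynomial ℕ ℤ) (v : Var)
    (f : MvPolynomial ℕ ℤ × MvPolynomial ℕ ℤ) :
    symEval ξ (Function.update S v f) =
      Function.update (symEval ξ S) v (aeval ξ f.1 * (aeval ξ f.2)⁻¹) := by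
  funext w
  by_cases h : w = v
  · subst h
    simp [symEval]
  · simp [symEval, h]

/-- A sum of signed fractions gives the final value of `y` wherever `T` terminates when started
from the assignment denoted by `S`. -/
def Expresses (L : List SignedFrac) (T : FinThread Ins)
    (S : Var → MvPolynomial ℕ ℤ × MvPolynomial ℕ ℤ) : Prop :=
  ∀ (M : Type u) [SignedMeadow M], Meadow.IsCancellation M → ∀ (ξ : ℕ → M) (β : Var → M),
    T.apply (symEval ξ S) = some β → β Var.y = sumEval ξ L

/-- The state can stay a fraction without signs: each sign instruction splits the run into three,
with the constant `0`, `1` or `-1` as result. Denominators may vanish, with `0⁻¹ = 0`. -/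
theorem exists_expresses (T : FinThread Ins) (S : Var → MvPolynomial ℕ ℤ × MvPolynomial ℕ ℤ) :
    ∃ L, Expresses.{u} L T S := by
  induction T generalizing S with
  | halt =>
    refine ⟨[⟨(S Var.y).1, (S Var.y).2, 1⟩], fun M _ h ξ β hβ => ?_⟩
    obtain rfl : symEval ξ S = β := by simpa [FinThread.apply] using hβ
    simp [sumEval, SignedFrac.eval, symEval, sgn_one]
  | dead => exact ⟨[], fun M _ h ξ β hβ => by simp [FinThread.apply] at hβ⟩
  | post T a T' ih ih' =>
    -- Covers the assignments whose result is given by one fraction in all cases.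
    have simple : ∀ (v : Var) (f : MvPolynomial ℕ ℤ × MvPolynomial ℕ ℤ),
        (∀ (M : Type u) [SignedMeadow M], Meadow.IsCancellation M → ∀ ξ : ℕ → M,
          a.ReplyTrue (symEval ξ S) ∧ a.effect (symEval ξ S) = Function.update (symEval ξ S) v
            (aeval ξ f.1 * (aeval ξ f.2)⁻¹)) → ∃ L, Expresses.{u} L (post T a T') S := by
      intro v f hf
      obtain ⟨L, hL⟩ := ih (Function.update S v f)
      refine ⟨L, fun M _ h ξ β hβ => hL M h ξ β ?_⟩
      obtain ⟨h1, h2⟩ := hf M h ξ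
      rwa [FinThread.apply, if_pos h1, h2, ← symEval_update] at hβ
    cases a with
    | cpIn i j =>
      exact simple (Var.a i) (S (Var.x j)) fun M _ h ξ => ⟨trivial, rfl⟩
    | cpOut j =>
      exact simple Var.y (S (Var.a j)) fun M _ h ξ => ⟨trivial, rfl⟩
    | setZero i =>
      exact simple (Var.a i) (0, 1) fun M _ h ξ => ⟨trivial, by simp [Ins.effect]⟩
    | setOne i =>
      exact simple (Var.a i) (1, 1) fun M _ h ξ => ⟨trivial, by simp [Ins.effect, h.inv_one]⟩
    | setNeg i =>
      exact simple (Var.a i) (-(S (Var.a i)).1, (S (Var.a i)).2) fun M _ h ξ =>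
        ⟨trivial, by simp [Ins.effect, symEval]⟩
    | setInv i =>
      refine simple (Var.a i) ((S (Var.a i)).2, (S (Var.a i)).1) fun M _ h ξ => ⟨trivial, ?_⟩
      let _ := h.field
      have hi : ∀ x y : M, (x * y⁻¹)⁻¹ = y * x⁻¹ := fun x y => by
        have h1 : (x * y⁻¹)⁻¹ = x⁻¹ * y⁻¹⁻¹ := mul_inv x y⁻¹
        rw [h1, Meadow.inv_invol, mul_comm]
      simp only [Ins.effect, symEval, hi]
    | setMul i j =>
      refine simple (Var.a i) ((S (Var.a i)).1 * (S (Var.a j)).1,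
        (S (Var.a i)).2 * (S (Var.a j)).2) fun M _ h ξ => ⟨trivial, ?_⟩
      let _ := h.field
      have hi : ∀ x y : M, (x * y)⁻¹ = x⁻¹ * y⁻¹ := fun x y => mul_inv x y
      simp only [Ins.effect, symEval, map_mul, hi]
      congr 1
      ring
    | testZero i =>
      obtain ⟨L, hL⟩ := ih S
      obtain ⟨L', hL'⟩ := ih' S
      -- As `0⁻¹ = 0`, the fraction `p · q⁻¹` vanishes iff `p · q` does; both nonzero signs lead to
      -- the false branch.
      obtain ⟨K, hK⟩ := exists_sumEval_cases.{u} ((S (Var.a i)).1 * (S (Var.a i)).2) L L' L'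
      refine ⟨K, fun M _ h ξ β hβ => ?_⟩
      let _ := h.field
      obtain ⟨h0, h1, h2⟩ := hK M h ξ
      have hz : symEval ξ S (Var.a i) = 0 ↔
          aeval ξ ((S (Var.a i)).1 * (S (Var.a i)).2) = 0 := by
        rw [map_mul]
        change _ * _ = 0 ↔ _
        simp only [mul_eq_zero]
        exact or_congr Iff.rfl inv_eq_zero
      rw [FinThread.apply] at hβ
      by_cases hr : symEval ξ S (Var.a i) = 0
      · rw [if_pos (show Ins.ReplyTrue (.testZero i) _ from hr)] at hβ
        rw [h0 (hz.mp hr)]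
        exact hL M h ξ β hβ
      · rw [if_neg (show ¬ Ins.ReplyTrue (.testZero i) _ from hr)] at hβ
        rw [hz] at hr
        rw [(sgn_eq_one_or h hr).elim h1 h2]
        exact hL' M h ξ β hβ
    | setSign i =>
      obtain ⟨L₀, hL₀⟩ := ih (Function.update S (Var.a i) (0, 1))
      obtain ⟨L₁, hL₁⟩ := ih (Function.update S (Var.a i) (1, 1))
      obtain ⟨L₂, hL₂⟩ := ih (Function.update S (Var.a i) (-1, 1))
      obtain ⟨K, hK⟩ := exists_sumEval_cases.{u} ((S (Var.a i)).1 * (S (Var.a i)).2) L₀ L₁ L₂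
      refine ⟨K, fun M _ h ξ β hβ => ?_⟩
      obtain ⟨h0, h1, h2⟩ := hK M h ξ
      have hs : sgn (symEval ξ S (Var.a i)) =
          sgn (aeval ξ ((S (Var.a i)).1 * (S (Var.a i)).2)) := by
        rw [map_mul, symEval, sgn_mul, sgn_mul, sgn_inv]
      rw [FinThread.apply, if_pos (show Ins.ReplyTrue (.setSign i) _ from trivial), Ins.effect, hs] at hβ
      by_cases hr : aeval ξ ((S (Var.a i)).1 * (S (Var.a i)).2) = 0
      · rw [h0 hr]
        apply hL₀ M h ξ β
        rw [symEval_update]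
        simpa [hr, sgn_zero] using hβ
      · rcases sgn_eq_one_or h hr with hr | hr
        · rw [h1 hr]
          apply hL₁ M h ξ β
          rw [symEval_update]
          simpa only [hr, map_one, h.inv_one, mul_one] using hβ
        · rw [h2 hr]
          apply hL₂ M h ξ β
          rw [symEval_update]
          simpa only [hr, map_one, map_neg, h.inv_one, mul_one] using hβ
    | setAdd i j =>
      -- The usual sum of fractions fails if a denominator is `0`. That summand is then `0`, and the
      -- other one is the result.
      obtain ⟨L₁, hL₁⟩ := ih (Function.update S (Var.a i) (S (Var.a j)))
      obtain ⟨L₂, hL₂⟩ := ih S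
      obtain ⟨L₃, hL₃⟩ := ih (Function.update S (Var.a i)
        ((S (Var.a i)).1 * (S (Var.a j)).2 + (S (Var.a j)).1 * (S (Var.a i)).2,
          (S (Var.a i)).2 * (S (Var.a j)).2))
      obtain ⟨K₁, hK₁⟩ := exists_sumEval_cases.{u} (S (Var.a j)).2 L₂ L₃ L₃
      obtain ⟨K, hK⟩ := exists_sumEval_cases.{u} (S (Var.a i)).2 L₁ K₁ K₁
      refine ⟨K, fun M _ h ξ β hβ => ?_⟩
      obtain ⟨h0, h1, h2⟩ := hK M h ξ
      obtain ⟨h0', h1', h2'⟩ := hK₁ M h ξ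
      rw [FinThread.apply, if_pos (show Ins.ReplyTrue (.setAdd i j) _ from trivial), Ins.effect] at hβ
      by_cases hr : aeval ξ (S (Var.a i)).2 = 0
      · rw [h0 hr]
        apply hL₁ M h ξ β
        rw [symEval_update]
        simpa only [symEval, hr, Meadow.inv_zero_eq, mul_zero, zero_add] using hβ
      · rw [(sgn_eq_one_or h hr).elim h1 h2]
        by_cases hr' : aeval ξ (S (Var.a j)).2 = 0
        · rw [h0' hr']
          apply hL₂ M h ξ β
          have hj : symEval ξ S (Var.a j) = 0 := by
            simp only [symEval, hr', Meadow.inv_zero_eq, mul_zero]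
          rwa [hj, add_zero, Function.update_eq_self] at hβ
        · rw [(sgn_eq_one_or h hr').elim h1' h2']
          apply hL₃ M h ξ β
          rw [symEval_update, ← hβ]
          congr 2
          let _ := h.field
          have hd : ∀ p q p' q' : M, q ≠ 0 → q' ≠ 0 →
              (p * q' + p' * q) * (q * q')⁻¹ = p * q⁻¹ + p' * q'⁻¹ := by
            intro p q p' q' hq hq'
            have := (div_add_div p p' hq hq').symm
            rw [div_eq_mul_inv, div_eq_mul_inv, div_eq_mul_inv, mul_comm q p'] at this
            exact this
          simp only [symEval, map_add, map_mul]
          rw [hd _ _ _ _ hr hr']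

end FinThread

/-! ## Code for sums of signed fractions -/

namespace RegisterCode

open SignedMeadow

/-- All auxiliary variables of the code are among `a_0, …, a_4`. -/
def Small (c : List Ins) : Prop := ∀ a ∈ c, ∀ i ∈ a.auxVars, i < 5

theorem Small.append {c d : List Ins} (hc : Small c) (hd : Small d) : Small (c ++ d) := by
  intro a ha
  rcases List.mem_append.mp ha with h | h
  · exact hc a h
  · exact hd a h

/-- The input variables and the auxiliary variables `a_i` with `i < n` have the same values. -/
def Agree {M : Type*} (n : ℕ) (α β : Var → M) : Prop :=
  (∀ j, α (Var.x j) = β (Var.x j)) ∧ ∀ i < n, α (Var.a i) = β (Var.a i)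

/-- The values of the input variables. -/
def inputs {M : Type*} (α : Var → M) : ℕ → M := fun j => α (Var.x j)

theorem Agree.inputs_eq {M : Type*} {n : ℕ} {α β : Var → M} (h : Agree n α β) :
    inputs α = inputs β := funext h.1

theorem Agree.trans {M : Type*} {n : ℕ} {α β γ : Var → M} (h : Agree n α β) (h' : Agree n β γ) :
    Agree n α γ := ⟨fun j => (h.1 j).trans (h'.1 j), fun i hi => (h.2 i hi).trans (h'.2 i hi)⟩

/-- The code leaves the inputs and `a_0, …, a_{n-1}` alone and assigns to `a_n` a value that
depends on its old value and the inputs. -/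
def Computes (n : ℕ) (c : List Ins)
    (g : ∀ (M : Type u) [SignedMeadow M], M → (ℕ → M) → M) : Prop :=
  Small c ∧ ∀ (M : Type u) [SignedMeadow M] (α : Var → M), Agree n (runCode c α) α ∧
    runCode c α (Var.a n) = g M (α (Var.a n)) (inputs α)

theorem Computes.comp {n : ℕ} {c d : List Ins}
    {g g' : ∀ (M : Type u) [SignedMeadow M], M → (ℕ → M) → M}
    (hc : Computes n c g) (hd : Computes n d g') :
    Computes n (c ++ d) (fun M _ z ξ => g' M (g M z ξ) ξ) := by
  refine ⟨hc.1.append hd.1, fun M _ α => ?_⟩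
  obtain ⟨h1, h2⟩ := hc.2 M α
  obtain ⟨h3, h4⟩ := hd.2 M (runCode c α)
  rw [runCode_append]
  exact ⟨h3.trans h1, by rw [h4, h2, h1.inputs_eq]⟩

theorem Computes.of_update {n : ℕ} (hn : n < 5) (u : Ins)
    {g : ∀ (M : Type u) [SignedMeadow M], M → (ℕ → M) → M} (hs : ∀ i ∈ u.auxVars, i = n)
    (hu : ∀ (M : Type u) [SignedMeadow M] (α : Var → M), u.effect α =
      Function.update α (Var.a n) (g M (α (Var.a n)) (inputs α))) :
    Computes n [u] g := by
  refine ⟨fun a ha i hi => ?_, fun M _ α => ⟨⟨fun j => ?_, fun i hi => ?_⟩, ?_⟩⟩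
  · rw [List.mem_singleton] at ha
    subst ha
    rwa [hs i hi]
  · simp [runCode, hu]
  · simp [runCode, hu, hi.ne]
  · simp [runCode, hu]

theorem computes_setOne {n : ℕ} (hn : n < 5) :
    Computes.{u} n [Ins.setOne n] (fun _ _ _ _ => 1) :=
  .of_update hn _ (fun _ h => h) fun _ _ _ => rfl

theorem computes_setNeg {n : ℕ} (hn : n < 5) :
    Computes.{u} n [Ins.setNeg n] (fun _ _ z _ => -z) :=
  .of_update hn _ (fun _ h => h) fun _ _ _ => rfl

theorem computes_setInv {n : ℕ} (hn : n < 5) :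
    Computes.{u} n [Ins.setInv n] (fun _ _ z _ => z⁻¹) :=
  .of_update hn _ (fun _ h => h) fun _ _ _ => rfl

theorem computes_setSign {n : ℕ} (hn : n < 5) :
    Computes.{u} n [Ins.setSign n] (fun _ _ z _ => sgn z) :=
  .of_update hn _ (fun _ h => h) fun _ _ _ => rfl

theorem computes_cpIn {n : ℕ} (hn : n < 5) (j : ℕ) :
    Computes.{u} n [Ins.cpIn n j] (fun _ _ _ ξ => ξ j) :=
  .of_update hn _ (fun _ h => h) fun _ _ _ => rfl

theorem computes_nil (n : ℕ) : Computes.{u} n [] (fun _ _ z _ => z) :=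
  ⟨fun _ h => absurd h (by simp), fun _ _ _ => ⟨⟨fun _ => rfl, fun _ _ => rfl⟩, rfl⟩⟩

theorem Computes.congr {n : ℕ} {c : List Ins}
    {g g' : ∀ (M : Type u) [SignedMeadow M], M → (ℕ → M) → M} (hc : Computes n c g)
    (h : ∀ (M : Type u) [SignedMeadow M] (z : M) (ξ : ℕ → M), g M z ξ = g' M z ξ) :
    Computes n c g' :=
  ⟨hc.1, fun M _ α => ⟨(hc.2 M α).1, by rw [(hc.2 M α).2, h]⟩⟩

/-- Code that combines `a_n` with a value computed in the next register. -/
theorem Computes.next {n : ℕ} (hn : n < 4) {c : List Ins}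
    {g : ∀ (M : Type u) [SignedMeadow M], M → (ℕ → M) → M} (hc : Computes (n + 1) c g)
    (u : Ins) (hs : ∀ i ∈ u.auxVars, i < 5) (f : ∀ (M : Type u) [SignedMeadow M], M → M → M)
    (hu : ∀ (M : Type u) [SignedMeadow M] (α : Var → M), u.effect α =
      Function.update α (Var.a n) (f M (α (Var.a n)) (α (Var.a (n + 1))))) :
    Computes n ([Ins.setZero (n + 1)] ++ c ++ [u]) (fun M _ z ξ => f M z (g M 0 ξ)) := by
  have h0 : Computes.{u} (n + 1) [Ins.setZero (n + 1)] (fun _ _ _ _ => 0) :=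
    .of_update (by omega) _ (fun _ h => h) fun _ _ _ => rfl
  have h1 := h0.comp hc
  refine ⟨h1.1.append fun a ha i hi => ?_, fun M _ α => ?_⟩
  · rw [List.mem_singleton] at ha
    subst ha
    exact hs i hi
  · obtain ⟨h2, h3⟩ := h1.2 M α
    rw [runCode_append]
    generalize runCode ([Ins.setZero (n + 1)] ++ c) α = γ at h2 h3 ⊢
    simp only [runCode, hu]
    refine ⟨⟨fun j => ?_, fun i hi => ?_⟩, ?_⟩
    · simp [h2.1 j]
    · simp [hi.ne, h2.2 i (by omega)]
    · simp [h2.2 n (by omega), h3]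

/-- Code that adds a value computed in the next register. -/
theorem Computes.addNext {n : ℕ} (hn : n < 4) {c : List Ins}
    {g : ∀ (M : Type u) [SignedMeadow M], M → (ℕ → M) → M} (hc : Computes (n + 1) c g) :
    Computes n ([Ins.setZero (n + 1)] ++ c ++ [Ins.setAdd n (n + 1)])
      (fun M _ z ξ => z + g M 0 ξ) :=
  hc.next hn _ (by simp [Ins.auxVars]; omega) (fun M _ z w => z + w) fun _ _ _ => rfl

/-- Code that multiplies by a value computed in the next register. -/
theorem Computes.mulNext {n : ℕ} (hn : n < 4) {c : List Ins}
    {g : ∀ (M : Type u) [SignedMeadow M], M → (ℕ → M) → M} (hc : Computes (n + 1) c g) :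
    Computes n ([Ins.setZero (n + 1)] ++ c ++ [Ins.setMul n (n + 1)])
      (fun M _ z ξ => z * g M 0 ξ) :=
  hc.next hn _ (by simp [Ins.auxVars]; omega) (fun M _ z w => z * w) fun _ _ _ => rfl

theorem exists_computes_mul_monomial (v : ℕ →₀ ℕ) :
    ∃ c, Computes.{u} 3 c (fun _ _ z ξ => z * aeval ξ (monomial v (1 : ℤ))) := by
  induction v using Finsupp.induction_linear with
  | zero => exact ⟨[], (computes_nil 3).congr fun M _ z ξ => by simp⟩
  | add v w hv hw =>
    obtain ⟨c, hc⟩ := hv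
    obtain ⟨d, hd⟩ := hw
    refine ⟨_, (hc.comp hd).congr fun M _ z ξ => ?_⟩
    rw [mul_assoc, ← map_mul, monomial_mul, one_mul]
  | single j e =>
    induction e with
    | zero => exact ⟨[], (computes_nil 3).congr fun M _ z ξ => by simp⟩
    | succ e ih =>
      obtain ⟨c, hc⟩ := ih
      refine ⟨_, (hc.comp ((computes_cpIn (by norm_num) j).mulNext (by norm_num))).congr
        fun M _ z ξ => ?_⟩
      have hm : monomial (Finsupp.single j (e + 1)) (1 : ℤ) =
          monomial (Finsupp.single j e) 1 * X j := by
        rw [X, monomial_mul, mul_one, Finsupp.single_add]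
      rw [hm, map_mul, aeval_X, mul_assoc]

/-- An integer coefficient is realized by adding or subtracting the monomial that many times,
rebuilt from `1` in `a_3` each time. The accumulating form `z + p` lets code for sums be
concatenated. -/
theorem exists_computes_add_polynomial (p : MvPolynomial ℕ ℤ) :
    ∃ c, Computes.{u} 2 c (fun _ _ z ξ => z + aeval ξ p) := by
  induction p using MvPolynomial.induction_on' with
  | add p q hp hq =>
    obtain ⟨c, hc⟩ := hp
    obtain ⟨d, hd⟩ := hq
    exact ⟨_, (hc.comp hd).congr fun M _ z ξ => by rw [map_add, add_assoc]⟩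
  | monomial v a =>
    obtain ⟨d, hd⟩ := exists_computes_mul_monomial.{u} v
    have hd' := (computes_setOne (by norm_num)).comp hd
    induction a using Int.induction_on with
    | zero => exact ⟨[], (computes_nil 2).congr fun M _ z ξ => by simp⟩
    | succ a ih =>
      obtain ⟨c, hc⟩ := ih
      refine ⟨_, (hc.comp (hd'.addNext (by norm_num))).congr fun M _ z ξ => ?_⟩
      rw [map_add (monomial v), map_add]
      ring
    | pred a ih =>
      obtain ⟨c, hc⟩ := ih
      refine ⟨_, (hc.comp ((hd'.comp (computes_setNeg (by norm_num))).addNext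
        (by norm_num))).congr fun M _ z ξ => ?_⟩
      rw [map_sub (monomial v), map_sub]
      ring

/-- Here `a_0` accumulates the sum, `a_1` builds a term from `1` by three multiplications, and `a_2`
supplies `p`, `q⁻¹` and `s(r)` in turn. -/
theorem exists_computes_add_sumEval (L : List SignedFrac) :
    ∃ c, Computes.{u} 0 c (fun _ _ z ξ => z + SignedFrac.sumEval ξ L) := by
  induction L with
  | nil => exact ⟨[], (computes_nil 0).congr fun M _ z ξ => by simp [SignedFrac.sumEval]⟩
  | cons t L ih =>
    obtain ⟨c, hc⟩ := ih
    obtain ⟨c₁, h₁⟩ := exists_computes_add_polynomial.{u} t.num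
    obtain ⟨c₂, h₂⟩ := exists_computes_add_polynomial.{u} t.den
    obtain ⟨c₃, h₃⟩ := exists_computes_add_polynomial.{u} t.arg
    refine ⟨_, (Computes.comp (Computes.addNext (by norm_num)
      ((((computes_setOne (by norm_num)).comp (h₁.mulNext (by norm_num))).comp
        ((h₂.comp (computes_setInv (by norm_num))).mulNext (by norm_num))).comp
        ((h₃.comp (computes_setSign (by norm_num))).mulNext (by norm_num)))) hc).congr
      fun M _ z ξ => ?_⟩
    simp [SignedFrac.sumEval, SignedFrac.eval, add_assoc]

end RegisterCode

open RegisterCode in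
/-- Sums of signed fractions are computed by straight-line code with five auxiliary variables. -/
theorem SignedFrac.exists_code (L : List SignedFrac) :
    ∃ c : List Ins, (InsSeq.ofCode c).UsesAuxVars 5 ∧
      ∀ (M : Type u) [SignedMeadow M] (α : Var → M),
        runCode c α Var.y = sumEval (fun j => α (Var.x j)) L := by
  obtain ⟨c, hc⟩ := exists_computes_add_sumEval.{u} L
  -- Only the start value `0` of `a_0` matters for the result; the other resets make all of `a_0, …,
  -- a_4` occur.
  refine ⟨[4, 3, 2, 1, 0].map Ins.setZero ++ c ++ [Ins.cpOut 0], fun i => ?_, fun M _ α => ?_⟩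
  · simp only [InsSeq.UsesAuxVar, InsSeq.occurs_ofCode]
    constructor
    · rintro ⟨a, ha, hi⟩
      rw [List.mem_append, List.mem_append] at ha
      rcases ha with (ha | ha) | ha
      · obtain ⟨j, hj, rfl⟩ := List.mem_map.mp ha
        have hij : i = j := hi
        simp at hj
        omega
      · exact hc.1 a ha i hi
      · rw [List.mem_singleton] at ha
        subst ha
        have hi0 : i = 0 := hi
        omega
    · intro hi
      refine ⟨Ins.setZero i, ?_, rfl⟩
      simp
      omega
  · rw [runCode_append, runCode_append]
    simp only [runCode, Ins.effect, Function.update_self]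
    rw [(hc.2 M _).2]
    simp only [List.map, runCode, Ins.effect, Function.update_self, zero_add]
    congr 1

theorem mainTheorem2 (I : InsSeq Ins) (k : ℕ)
    (hI : ∀ (M : Type u) [SignedMeadow M], Meadow.IsCancellation M →
      ∀ m : Fin (k + 1) → M, (I.sem M k m).Dom) :
    ∃ J : InsSeq Ins, J.IsStraightLine ∧ (∃ n ≤ 8, J.UsesAuxVars n) ∧
      ∀ (M : Type u) [SignedMeadow M], Meadow.IsCancellation M → I.sem M k = J.sem M k := by
  obtain ⟨N, hN⟩ := Thread.exists_uniform_bound I.thread k hI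
  let S : Var → MvPolynomial ℕ ℤ × MvPolynomial ℕ ℤ := fun v =>
    match v with
    | Var.x j => (X j, 1)
    | _ => (0, 1)
  -- Termination within `N` steps is visible at depth `N + 1`.
  obtain ⟨L, hL⟩ := FinThread.exists_expresses.{u} (Thread.proj (N + 1) I.thread) S
  obtain ⟨c, hc, hcL⟩ := SignedFrac.exists_code.{u} L
  refine ⟨InsSeq.ofCode c, InsSeq.isStraightLine_ofCode c, ⟨5, by norm_num, hc⟩, ?_⟩
  intro M _ h
  funext m
  obtain ⟨β, hβ⟩ := Option.isSome_iff_exists.mp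
    ((Thread.mem_termSet_iff _ _ _).mp (hN M h m))
  -- The polynomials are evaluated with the value `0` for every input variable beyond `x_k`, as in
  -- the initial assignment.
  have hS : FinThread.symEval (fun j => initAssignment m (Var.x j)) S = initAssignment m := by
    funext v
    cases v <;> simp [FinThread.symEval, S, h.inv_one, initAssignment]
  rw [InsSeq.sem_ofCode, hcL, InsSeq.sem, Thread.sem_eq_some hβ,
    hL M h (fun j => initAssignment m (Var.x j)) β (by rwa [hS])]
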